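/- **Theorem.** Let $X$ be a path connected, locally path connected topological space, and let $x_0\in X$. Then $X$ is lasso homotopically Hausdorff if and only if $X$ is shape injective, that is, the canonical homomorphism $\pi_1(X,x_0)\to\check\pi_1(X,x_0)$ is injective. Here the notions are as follows. - An open cover $\mathcal U$ of $X$ is *normal* if there is a locally finite partition of unity $\{\phi_U\colon X\to[0,1]\}_{U\in\mathcal U}$ with $\phi_U^{-1}(0,1]\subseteq U$ for every $U\in\mathcal U$. - For an open cover $\mathcal U$ and $x\in X$, $\pi(\mathcal U,x)$ is the subgroup of $\pi_1(X,x)$ generated by the classes $[\alpha\gamma\alpha^{-1}]$, where $\alpha$ is a path in $X$ starting at $x$ and $\gamma$ is a loop, based at the endpoint of $\alpha$, whose image lies in some $U\in\mathcal U$. The space $X$ is *lasso homotopically Hausdorff* if for every $x\in X$ and every $[\gamma]\neq 1$ in $\pi_1(X,x)$ there is a normal open cover $\mathcal U$ of $X$ with $[\gamma]\notin\pi(\mathcal U,x)$; equivalently, $\bigcap_{\mathcal U}\pi(\mathcal U,x)=1$ for every $x\in X$, where $\mathcal U$ runs over all normal open covers of $X$. - The nerve $N(\mathcal U)$ is the simplicial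 complex whose simplices are the nonempty finite subsets of $\mathcal U$ with nonempty intersection; $|N(\mathcal U)|$ is its geometric realization with the weak topology. A pointed normal cover $(\mathcal U,U_0)$ is a normal open cover $\mathcal U$ with a chosen $U_0\in\mathcal U$ containing $x_0$. A bonding map from $(\mathcal V,V_0)$ to $(\mathcal U,U_0)$ is a map $p\colon\mathcal V\to\mathcal U$ with $V\subseteq p(V)$ for all $V\in\mathcal V$ and $p(V_0)=U_0$; it induces a homomorphism $p_*\colon\pi_1(|N(\mathcal V)|,V_0)\to\pi_1(|N(\mathcal U)|,U_0)$. The *shape group* $\check\pi_1(X,x_0)$ is the inverse limit $\varprojlim\pi_1(|N(\mathcal U)|,U_0)$ over all pointed normal covers, that is, the group of all families $(g_{(\mathcal U,U_0)})$ with $p_*(g_{(\mathcal V,V_0)})=g_{(\mathcal U,U_0)}$ for all bonding maps $p$. - The canonical homomorphism $\pi_1(X,x_0)\to\check\pi_1(X,x_0)$ has as its component at $(\mathcal U,U_0)$ the homomorphism induced by $\phi\colon X\to|N(\mathcal U)|$, $\phi(x)=\sum_{U\in\mathcal U}\phi_U(x)\,U$, for a partition of unity as above, followed by the change of base point from $\phi(x_0)$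 to the vertex $U_0$ along the straight segment (both points lie in a common closed simplex); it does not depend on the choice of the partition of unity. -/

import Mathlib

open scoped unitInterval

/-! ### Geometric realization of a simplicial complex -/

/-- The underlying set of the geometric realization of `K`: formal convex combinations of vertices
whose support is a simplex of `K` (barycentric coordinates). -/
structure Realization {V : Type*} (K : PreAbstractSimplicialComplex V) where
  weight : V →₀ ℝ
  nonneg : ∀ v, 0 ≤ weight v
  support_mem : weight.support ∈ K.faces
  sum_eq_one : (weight.sum fun _ a => a) = 1

namespace Realization

variable {V W : Type*} {K : PreAbstractSimplicialComplex V} {L : PreAbstractSimplicialComplex W}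

theorem ext' {p q : Realization K} (h : p.weight = q.weight) : p = q := by
  cases p; cases q; cases h; rfl

/-- The closed simplex of the realization spanned by the finite set of vertices `s`. -/
abbrev ClosedSimplex (K : PreAbstractSimplicialComplex V) (s : Finset V) :=
  {p : Realization K // p.weight.support ⊆ s}

/-- A closed simplex carries the Euclidean topology of its barycentric coordinates. -/
@[reducible] def simplexTopology (K : PreAbstractSimplicialComplex V) (s : Finset V) :
    TopologicalSpace (ClosedSimplex K s) :=
  TopologicalSpace.induced (fun p (v : V) => p.1.weight v) inferInstance

/-- The weak topology: the finest topology for which the inclusions of all closed simplices, with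
their Euclidean topologies, are continuous. -/
instance : TopologicalSpace (Realization K) :=
  ⨆ s : K.faces, TopologicalSpace.coinduced
    (Subtype.val : ClosedSimplex K s.1 → Realization K) (simplexTopology K s.1)

theorem continuous_dom {Z : Type*} [TopologicalSpace Z] {f : Realization K → Z}
    (h : ∀ s ∈ K.faces, @Continuous _ _ (simplexTopology K s) _
      (fun p : ClosedSimplex K s => f p.1)) : Continuous f := by
  refine continuous_iSup_dom.2 fun s => ?_
  exact continuous_coinduced_dom.2 (h s.1 s.2)

theorem continuous_simplex {s : Finset V} (hs : s ∈ K.faces) :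
    @Continuous _ _ (simplexTopology K s) _
      (Subtype.val : ClosedSimplex K s → Realization K) :=
  continuous_iSup_rng (i := (⟨s, hs⟩ : K.faces)) continuous_coinduced_rng

theorem continuous_weight (v : V) : Continuous fun p : Realization K => p.weight v :=
  continuous_dom fun s _ => by
    let _ := simplexTopology K s
    exact (continuous_apply v).comp continuous_induced_dom

/-- A map into a realization is continuous if its barycentric coordinates are and if locally only
finitely many vertices occur. -/
theorem continuous_cod {Y : Type*} [TopologicalSpace Y] {f : Y → Realization K}
    (hc : ∀ v, Continuous fun y => (f y).weight v)
    (hf : ∀ y, ∃ F : Finset V, ∀ᶠ z in nhds y, (f z).weight.support ⊆ F) : Continuous f := by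
  rw [continuous_iff_continuousAt]
  intro y
  obtain ⟨F, hF⟩ := hf y
  let J := {s : Finset V // s ∈ F.powerset ∧ s ∈ K.faces}
  have hJ : Finite J := ((F.powerset.finite_toSet).subset
    (fun s (hs : s ∈ F.powerset ∧ s ∈ K.faces) => hs.1)).to_subtype
  let C : J → Set Y := fun s => {z | (f z).weight.support ⊆ s.1}
  have hC : ∀ s, IsClosed (C s) := by
    intro s
    have : C s = ⋂ v : {v // v ∉ s.1}, {z | (f z).weight v.1 = 0} := by
      ext z
      simp only [C, Set.mem_iInter, Set.mem_ofPred_eq, Subtype.forall]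
      constructor
      · intro h v hv
        by_contra h0
        exact hv (h (Finsupp.mem_support_iff.2 h0))
      · intro h v hv
        by_contra h0
        exact Finsupp.mem_support_iff.1 hv (h v h0)
    rw [this]
    exact isClosed_iInter fun v => isClosed_eq (hc v.1) continuous_const
  have hcont : ∀ s, ContinuousOn f (C s) := by
    intro s
    rw [continuousOn_iff_continuous_domRestrict]
    let _ := simplexTopology K s.1
    have h1 : Continuous (fun z : C s => (⟨f z.1, z.2⟩ : ClosedSimplex K s.1)) :=
      continuous_induced_rng.2 (continuous_pi fun v => (hc v).comp continuous_subtype_val)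
    exact (continuous_simplex s.2.2).comp h1
  have hU : ContinuousOn f (⋃ s, C s) :=
    (locallyFinite_of_finite C).continuousOn_iUnion hC hcont
  refine hU.continuousAt (Filter.mem_of_superset hF fun z hz => ?_)
  exact Set.mem_iUnion.2 ⟨⟨(f z).weight.support, Finset.mem_powerset.2 hz, (f z).support_mem⟩,
    Finset.Subset.refl _⟩

/-- The point of the realization given by a vertex. -/
noncomputable def vertex (v : V) (hv : {v} ∈ K.faces) : Realization K where
  weight := Finsupp.single v 1
  nonneg w := by
    classical
    rw [Finsupp.single_apply]; split_ifs <;> norm_num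
  support_mem := by rwa [Finsupp.support_single v one_ne_zero]
  sum_eq_one := by simp

/-- The convex combination `(1 - t) p + t q` of two points lying in a common simplex. -/
noncomputable def comb [DecidableEq V] (p q : Realization K)
    (h : p.weight.support ∪ q.weight.support ∈ K.faces) (t : I) : Realization K where
  weight := (1 - (t : ℝ)) • p.weight + (t : ℝ) • q.weight
  nonneg v := by
    have h1 : 0 ≤ 1 - (t : ℝ) := sub_nonneg.2 t.2.2
    have := mul_nonneg h1 (p.nonneg v)
    have := mul_nonneg t.2.1 (q.nonneg v)
    simp only [Finsupp.add_apply, Finsupp.smul_apply, smul_eq_mul]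
    positivity
  support_mem := by
    refine (K.isRelLowerSet_faces h).2 ?_ ?_
    · refine Finsupp.support_add.trans (Finset.union_subset_union ?_ ?_) <;>
        exact Finsupp.support_smul
    · rw [Finset.nonempty_iff_ne_empty, Ne, Finsupp.support_eq_empty]
      intro h0
      have h2 : ((1 - (t : ℝ)) • p.weight + (t : ℝ) • q.weight).sum (fun _ a => a) = 1 := by
        rw [Finsupp.sum_add_index' (by simp) (by simp), Finsupp.sum_smul_index (by simp),
          Finsupp.sum_smul_index (by simp), ← Finsupp.mul_sum, ← Finsupp.mul_sum,
          p.sum_eq_one, q.sum_eq_one]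
        ring
      rw [h0] at h2
      simp at h2
  sum_eq_one := by
    rw [Finsupp.sum_add_index' (by simp) (by simp), Finsupp.sum_smul_index (by simp),
      Finsupp.sum_smul_index (by simp), ← Finsupp.mul_sum, ← Finsupp.mul_sum,
      p.sum_eq_one, q.sum_eq_one]
    ring

theorem comb_apply [DecidableEq V] (p q : Realization K)
    (h : p.weight.support ∪ q.weight.support ∈ K.faces) (t : I) (v : V) :
    (comb p q h t).weight v = (1 - (t : ℝ)) * p.weight v + (t : ℝ) * q.weight v := by
  simp [comb]

theorem comb_support [DecidableEq V] (p q : Realization K)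
    (h : p.weight.support ∪ q.weight.support ∈ K.faces) (t : I) :
    (comb p q h t).weight.support ⊆ p.weight.support ∪ q.weight.support := by
  refine Finsupp.support_add.trans (Finset.union_subset_union ?_ ?_) <;>
    exact Finsupp.support_smul

theorem comb_zero [DecidableEq V] (p q : Realization K)
    (h : p.weight.support ∪ q.weight.support ∈ K.faces) : comb p q h 0 = p :=
  ext' (by ext v; rw [comb_apply]; simp)

theorem comb_one [DecidableEq V] (p q : Realization K)
    (h : p.weight.support ∪ q.weight.support ∈ K.faces) : comb p q h 1 = q :=
  ext' (by ext v; rw [comb_apply]; simp)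

theorem comb_self [DecidableEq V] (p : Realization K)
    (h : p.weight.support ∪ p.weight.support ∈ K.faces) (t : I) : comb p p h t = p :=
  ext' (by ext v; rw [comb_apply]; ring)

/-- The straight segment from `p` to `q` inside a common simplex. -/
noncomputable def segment [DecidableEq V] (p q : Realization K)
    (h : p.weight.support ∪ q.weight.support ∈ K.faces) : Path p q where
  toFun := comb p q h
  continuous_toFun := by
    refine continuous_cod (fun v => ?_) fun t =>
      ⟨_, Filter.Eventually.of_forall fun z => comb_support p q h z⟩
    simp only [comb_apply]
    fun_prop
  source' := comb_zero p q h
  target' := comb_one p q h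

/-- Two paths that lie pointwise in common simplices and meet finitely many vertices are
homotopic. -/
theorem homotopic_of_contiguous [DecidableEq V] {p q : Realization K} (a b : Path p q)
    (h : ∀ t, (a t).weight.support ∪ (b t).weight.support ∈ K.faces) (F : Finset V)
    (hF : ∀ t, (a t).weight.support ∪ (b t).weight.support ⊆ F) : a.Homotopic b := by
  refine ⟨⟨⟨⟨fun z => comb (a z.2) (b z.2) (h z.2) z.1, ?_⟩, ?_, ?_⟩, ?_⟩⟩
  · refine continuous_cod (fun v => ?_) fun z =>
      ⟨F, Filter.Eventually.of_forall fun z => (comb_support _ _ _ _).trans (hF _)⟩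
    simp only [comb_apply]
    have ha : Continuous fun z : I × I => (a z.2).weight v :=
      (continuous_weight v).comp (a.continuous.comp continuous_snd)
    have hb : Continuous fun z : I × I => (b z.2).weight v :=
      (continuous_weight v).comp (b.continuous.comp continuous_snd)
    fun_prop
  · intro t; exact comb_zero _ _ (h t)
  · intro t; exact comb_one _ _ (h t)
  · intro t x hx
    refine ext' ?_
    ext v
    change (comb (a x) (b x) (h x) t).weight v = (a x).weight v
    have hab : a x = b x := by
      rcases hx with rfl | rfl
      · rw [a.source, b.source]
      · rw [a.target, b.target]
    rw [comb_apply, hab]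
    ring

theorem sum_mapDomain (f : V → W) (w : V →₀ ℝ) :
    (w.mapDomain f).sum (fun _ a => a) = w.sum fun _ a => a :=
  Finsupp.sum_mapDomain_index (fun _ => rfl) (fun _ _ _ => rfl)

/-- The affine map of realizations induced by a simplicial map, on points. -/
noncomputable def mapFun [DecidableEq W] (f : V → W) (hf : ∀ s ∈ K.faces, s.image f ∈ L.faces)
    (p : Realization K) : Realization L where
  weight := p.weight.mapDomain f
  nonneg w := by
    classical
    rw [Finsupp.mapDomain, Finsupp.sum_apply]
    refine Finset.sum_nonneg fun v _ => ?_
    change 0 ≤ (Finsupp.single (f v) (p.weight v)) w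
    rw [Finsupp.single_apply]
    split_ifs
    · exact p.nonneg v
    · exact le_rfl
  support_mem := by
    refine (L.isRelLowerSet_faces (hf _ p.support_mem)).2 Finsupp.mapDomain_support ?_
    rw [Finset.nonempty_iff_ne_empty, Ne, Finsupp.support_eq_empty]
    intro h0
    have := (sum_mapDomain f p.weight).trans p.sum_eq_one
    rw [h0] at this
    simp at this
  sum_eq_one := (sum_mapDomain f p.weight).trans p.sum_eq_one

/-- The continuous map of realizations induced by a simplicial map. -/
noncomputable def map [DecidableEq W] (f : V → W) (hf : ∀ s ∈ K.faces, s.image f ∈ L.faces) :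
    C(Realization K, Realization L) where
  toFun := mapFun f hf
  continuous_toFun := by
    classical
    refine continuous_dom fun s hs => ?_
    let _ := simplexTopology K s
    refine continuous_cod (fun w => ?_) fun p => ⟨s.image f, Filter.Eventually.of_forall fun q =>
      Finsupp.mapDomain_support.trans (Finset.image_subset_image q.2)⟩
    have : ∀ p : ClosedSimplex K s, (mapFun f hf p.1).weight w =
        ∑ v ∈ s, if f v = w then p.1.weight v else 0 := by
      intro p
      change (p.1.weight.mapDomain f) w = _
      rw [Finsupp.mapDomain, Finsupp.sum_apply, Finsupp.sum_of_support_subset _ p.2]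
      · simp only [Finsupp.single_apply]
      · simp
    simp only [this]
    refine continuous_finsetSum _ fun v _ => ?_
    split_ifs
    · exact (continuous_apply v).comp continuous_induced_dom
    · exact continuous_const

end Realization

/-! ### Normal open covers and their nerves -/

section Covers

variable {X : Type*}

/-- The nerve of a family of sets. -/
def nerve (𝒰 : Set (Set X)) : PreAbstractSimplicialComplex 𝒰 where
  faces := {s | s.Nonempty ∧ (⋂ U ∈ s, (U : Set X)).Nonempty}
  isRelLowerSet_faces := fun {_} hs => ⟨hs.1, fun _ hts ht =>
    ⟨ht, hs.2.mono (Set.biInter_subset_biInter_left hts)⟩⟩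

theorem mem_nerve {𝒰 : Set (Set X)} {s : Finset 𝒰} (hs : s.Nonempty) (x : X)
    (h : ∀ U ∈ s, x ∈ U.1) : s ∈ (nerve 𝒰).faces :=
  ⟨hs, x, Set.mem_iInter₂.2 h⟩

variable [TopologicalSpace X]

/-- A normal open cover: an open cover with a (locally finite, continuous) partition of unity
`φ_U`, `U ∈ 𝒰`, such that `φ_U⁻¹ (0, 1] ⊆ U`. -/
structure IsNormalCover (𝒰 : Set (Set X)) : Prop where
  isOpen : ∀ U ∈ 𝒰, IsOpen U
  cover : ⋃₀ 𝒰 = Set.univ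
  exists_partition : ∃ φ : PartitionOfUnity 𝒰 X, ∀ U : 𝒰, Function.support (φ U) ⊆ U.1

theorem Realization.support_nonempty {V : Type*} {K : PreAbstractSimplicialComplex V}
    (p : Realization K) : p.weight.support.Nonempty :=
  (K.isRelLowerSet_faces p.support_mem).1

/-- The point `∑ φ_U(x) U` of the realization of the nerve. -/
noncomputable def nerveMapFun {𝒰 : Set (Set X)} (φ : PartitionOfUnity 𝒰 X)
    (hφ : ∀ U : 𝒰, Function.support (φ U) ⊆ U.1) (x : X) : Realization (nerve 𝒰) where
  weight := Finsupp.ofSupportFinite (fun U => φ U x) (φ.locallyFinite.point_finite x)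
  nonneg U := φ.nonneg U x
  support_mem := by
    refine mem_nerve ?_ x fun U hU => hφ U (Finsupp.mem_support_iff.1 hU)
    obtain ⟨U, hU⟩ := φ.exists_pos (Set.mem_univ x)
    exact ⟨U, Finsupp.mem_support_iff.2 hU.ne'⟩
  sum_eq_one := by
    rw [← φ.sum_eq_one (Set.mem_univ x)]
    rw [finsum_eq_sum_of_support_subset (s := (Finsupp.ofSupportFinite (fun U => φ U x)
      (φ.locallyFinite.point_finite x)).support)]
    · rfl
    · intro U hU
      exact Finsupp.mem_support_iff.2 hU

theorem nerveMapFun_mem {𝒰 : Set (Set X)} {φ : PartitionOfUnity 𝒰 X}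
    (hφ : ∀ U : 𝒰, Function.support (φ U) ⊆ U.1) {x : X} {U : 𝒰}
    (h : U ∈ (nerveMapFun φ hφ x).weight.support) : x ∈ U.1 :=
  hφ U (Finsupp.mem_support_iff.1 h)

/-- The canonical map `x ↦ ∑ φ_U(x) U` from a space to the nerve of a normal open cover. -/
noncomputable def nerveMap {𝒰 : Set (Set X)} (φ : PartitionOfUnity 𝒰 X)
    (hφ : ∀ U : 𝒰, Function.support (φ U) ⊆ U.1) : C(X, Realization (nerve 𝒰)) where
  toFun := nerveMapFun φ hφ
  continuous_toFun := by
    refine Realization.continuous_cod (fun U => (φ U).continuous) fun x => ?_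
    obtain ⟨O, hO, hfin⟩ := φ.locallyFinite x
    refine ⟨hfin.toFinset, Filter.mem_of_superset hO fun z hz U hU => ?_⟩
    exact hfin.mem_toFinset.2 ⟨z, Finsupp.mem_support_iff.1 hU, hz⟩

/-- A normal open cover with a distinguished member containing the base point. -/
structure PointedNormalCover (x₀ : X) where
  sets : Set (Set X)
  normal : IsNormalCover sets
  base : sets
  mem_base : x₀ ∈ base.1

/-- A bonding map: `P` refines `Q`, and each member of `P` is sent to a member of `Q` containing
it, the distinguished member to the distinguished member. -/
structure BondingMap {x₀ : X} (P Q : PointedNormalCover x₀) where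
  toFun : P.sets → Q.sets
  subset : ∀ U : P.sets, (U : Set X) ⊆ (toFun U : Set X)
  map_base : toFun P.base = Q.base

namespace PointedNormalCover

open Realization

variable {x₀ : X} (P Q : PointedNormalCover x₀)

/-- The realization of the nerve. -/
abbrev Nerve := Realization (nerve P.sets)

/-- The base point of the nerve: the distinguished member, as a vertex. -/
noncomputable def basepoint : P.Nerve :=
  vertex P.base (mem_nerve ⟨_, Finset.mem_singleton_self _⟩ x₀ fun _ hU =>
    (Finset.mem_singleton.1 hU) ▸ P.mem_base)

theorem basepoint_mem {U : P.sets} (h : U ∈ P.basepoint.weight.support) : U = P.base := by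
  have : P.basepoint.weight = Finsupp.single P.base 1 := rfl
  rw [this, Finsupp.support_single P.base one_ne_zero] at h
  exact Finset.mem_singleton.1 h

/-- A canonical map from `X` to the nerve; it depends on the choice of a partition of unity. -/
noncomputable def canonicalMap : C(X, P.Nerve) :=
  nerveMap P.normal.exists_partition.choose P.normal.exists_partition.choose_spec

theorem canonicalMap_mem {x : X} {U : P.sets}
    (h : U ∈ (P.canonicalMap x).weight.support) : x ∈ U.1 :=
  nerveMapFun_mem P.normal.exists_partition.choose_spec h

open Classical in
theorem union_mem : (P.canonicalMap x₀).weight.support ∪ P.basepoint.weight.support ∈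
    (nerve P.sets).faces := by
  refine mem_nerve ((support_nonempty _).mono Finset.subset_union_left) x₀ fun U hU => ?_
  rcases Finset.mem_union.1 hU with h | h
  · exact P.canonicalMap_mem h
  · exact P.basepoint_mem h ▸ P.mem_base

open Classical in
/-- The straight path in the nerve from the image of `x₀` to the base vertex: both lie in a common
simplex. -/
noncomputable def basePath : Path (P.canonicalMap x₀) P.basepoint :=
  segment _ _ P.union_mem

/-- The homomorphism of fundamental groups induced by the canonical map `X → |N(𝒰)|`, the base
point being moved to the base vertex along the straight path. -/
noncomputable def toNerve : FundamentalGroup X x₀ →* FundamentalGroup P.Nerve P.basepoint :=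
  (FundamentalGroup.fundamentalGroupMulEquivOfPath P.basePath).toMonoidHom.comp
    (FundamentalGroup.map P.canonicalMap x₀)

end PointedNormalCover

namespace BondingMap

open Realization

variable {x₀ : X} {P Q : PointedNormalCover x₀}

open Classical in
theorem image_mem (b : BondingMap P Q) :
    ∀ s ∈ (nerve P.sets).faces, s.image b.toFun ∈ (nerve Q.sets).faces := by
  rintro s ⟨hs, x, hx⟩
  refine mem_nerve (hs.image _) x fun U hU => ?_
  obtain ⟨U', hU', rfl⟩ := Finset.mem_image.1 hU
  exact b.subset U' (Set.mem_iInter₂.1 hx U' hU')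

open Classical in
/-- The map of nerves induced by a bonding map. -/
noncomputable def nerveMap (b : BondingMap P Q) : C(P.Nerve, Q.Nerve) :=
  Realization.map b.toFun b.image_mem

theorem nerveMap_basepoint (b : BondingMap P Q) : b.nerveMap P.basepoint = Q.basepoint := by
  refine ext' ?_
  change (Finsupp.single P.base (1 : ℝ)).mapDomain b.toFun = Finsupp.single Q.base 1
  rw [Finsupp.mapDomain_single, b.map_base]

/-- The homomorphism of fundamental groups induced by a bonding map. -/
noncomputable def hom (b : BondingMap P Q) :
    FundamentalGroup P.Nerve P.basepoint →* FundamentalGroup Q.Nerve Q.basepoint :=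
  FundamentalGroup.mapOfEq b.nerveMap b.nerveMap_basepoint

end BondingMap

/-! ### The shape group and the canonical homomorphism into it -/

/-- The (first) shape group: the inverse limit of the fundamental groups of the nerves of all
pointed normal open covers along the bonding homomorphisms (different bonding maps between the same
two pointed covers are contiguous, hence induce the same homomorphism). -/
def shapeGroup (x₀ : X) :
    Subgroup (∀ P : PointedNormalCover x₀, FundamentalGroup P.Nerve P.basepoint) where
  carrier := {g | ∀ (P Q : PointedNormalCover x₀) (b : BondingMap P Q), b.hom (g P) = g Q}
  mul_mem' := fun {g h} hg hh P Q b => by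
    rw [Pi.mul_apply, Pi.mul_apply, map_mul, hg, hh]
  one_mem' := fun P Q b => by rw [Pi.one_apply, Pi.one_apply, map_one]
  inv_mem' := fun {g} hg P Q b => by rw [Pi.inv_apply, Pi.inv_apply, map_inv, hg]

/-- The path `a` in the nerve meets finitely many vertices and each point `a t` has only vertices
containing `g t`. -/
def CarriedBy {𝒰 : Set (Set X)} {p q : Realization (nerve 𝒰)} {x y : X} (a : Path p q)
    (g : Path x y) : Prop :=
  (∃ F : Finset 𝒰, ∀ t, (a t).weight.support ⊆ F) ∧
    ∀ t, ∀ U ∈ (a t).weight.support, g t ∈ U.1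

namespace CarriedBy

open Realization

variable {𝒰 : Set (Set X)} {p q r : Realization (nerve 𝒰)} {x y z : X}

theorem trans {a : Path p q} {b : Path q r} {g : Path x y} {h : Path y z}
    (ha : CarriedBy a g) (hb : CarriedBy b h) : CarriedBy (a.trans b) (g.trans h) := by
  classical
  obtain ⟨⟨F, hF⟩, ha⟩ := ha
  obtain ⟨⟨G, hG⟩, hb⟩ := hb
  refine ⟨⟨F ∪ G, fun t => ?_⟩, fun t => ?_⟩
  · rw [Path.trans_apply]
    split_ifs
    · exact (hF _).trans Finset.subset_union_left
    · exact (hG _).trans Finset.subset_union_right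
  · rw [Path.trans_apply, Path.trans_apply]
    split_ifs
    · exact ha _
    · exact hb _

theorem symm {a : Path p q} {g : Path x y} (ha : CarriedBy a g) :
    CarriedBy a.symm g.symm :=
  ⟨⟨ha.1.choose, fun t => ha.1.choose_spec (σ t)⟩, fun t => ha.2 (σ t)⟩

theorem cast {a : Path p q} {g : Path x y} (ha : CarriedBy a g) {p' q' : Realization (nerve 𝒰)}
    (hp : p' = p) (hq : q' = q) : CarriedBy (a.cast hp hq) g := ha

theorem homotopic {a b : Path p q} {g : Path x y} (ha : CarriedBy a g) (hb : CarriedBy b g) :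
    a.Homotopic b := by
  classical
  obtain ⟨⟨F, hF⟩, ha⟩ := ha
  obtain ⟨⟨G, hG⟩, hb⟩ := hb
  refine homotopic_of_contiguous a b (fun t => ?_) (F ∪ G)
    fun t => Finset.union_subset_union (hF t) (hG t)
  refine mem_nerve ((support_nonempty _).mono Finset.subset_union_left) (g t) fun U hU => ?_
  exact (Finset.mem_union.1 hU).elim (ha t U) (hb t U)

theorem map {x₀ : X} {P Q : PointedNormalCover x₀} (b : BondingMap P Q) {p q : P.Nerve}
    {a : Path p q} {g : Path x y} (ha : CarriedBy a g) :
    CarriedBy (a.map b.nerveMap.continuous) g := by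
  classical
  obtain ⟨⟨F, hF⟩, ha⟩ := ha
  have key : ∀ t, ((a.map b.nerveMap.continuous) t).weight.support ⊆
      (a t).weight.support.image b.toFun := fun t => Finsupp.mapDomain_support
  refine ⟨⟨F.image b.toFun, fun t => (key t).trans (Finset.image_subset_image (hF t))⟩,
    fun t U hU => ?_⟩
  obtain ⟨U', hU', rfl⟩ := Finset.mem_image.1 (key t hU)
  exact b.subset U' (ha t U' hU')

theorem canonicalMap {x₀ : X} (P : PointedNormalCover x₀) (g : Path x y) :
    CarriedBy (g.map P.canonicalMap.continuous) g := by
  refine ⟨?_, fun t U hU => P.canonicalMap_mem hU⟩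
  have hfin := P.normal.exists_partition.choose.locallyFinite.finite_nonempty_inter_compact
    (isCompact_range g.continuous)
  refine ⟨hfin.toFinset, fun t U hU => hfin.mem_toFinset.2 ⟨g t, ?_, t, rfl⟩⟩
  exact Finsupp.mem_support_iff.1 hU

theorem basePath {x₀ : X} (P : PointedNormalCover x₀) :
    CarriedBy P.basePath (Path.refl x₀) := by
  classical
  have key : ∀ t, (P.basePath t).weight.support ⊆
      (P.canonicalMap x₀).weight.support ∪ P.basepoint.weight.support :=
    fun t => comb_support _ _ P.union_mem t
  refine ⟨⟨_, key⟩, fun t U hU => ?_⟩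
  rcases Finset.mem_union.1 (key t hU) with h | h
  · exact P.canonicalMap_mem h
  · exact P.basepoint_mem h ▸ P.mem_base

end CarriedBy

namespace PointedNormalCover

variable {x₀ : X}

theorem toNerve_mk (P : PointedNormalCover x₀) (β : Path x₀ x₀) :
    P.toNerve (FundamentalGroup.fromPath (Path.Homotopic.Quotient.mk β)) =
      FundamentalGroup.fromPath (Path.Homotopic.Quotient.mk
        (P.basePath.symm.trans ((β.map P.canonicalMap.continuous).trans P.basePath))) := rfl

theorem hom_toNerve {P Q : PointedNormalCover x₀} (b : BondingMap P Q)
    (g : FundamentalGroup X x₀) : b.hom (P.toNerve g) = Q.toNerve g := by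
  obtain ⟨β, rfl⟩ := Path.Homotopic.Quotient.mk_surjective g
  erw [toNerve_mk P β, toNerve_mk Q β, BondingMap.hom, FundamentalGroup.mapOfEq_apply]
  have h : ∀ R : PointedNormalCover x₀, CarriedBy
      (R.basePath.symm.trans ((β.map R.canonicalMap.continuous).trans R.basePath))
      ((Path.refl x₀).symm.trans (β.trans (Path.refl x₀))) := fun R =>
    (CarriedBy.basePath R).symm.trans ((CarriedBy.canonicalMap R β).trans (CarriedBy.basePath R))
  exact Path.Homotopic.Quotient.eq.2 ((((h P).map b).cast _ _).homotopic (h Q))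

end PointedNormalCover

/-- The canonical homomorphism `π₁(X, x₀) → π̌₁(X, x₀)`. -/
noncomputable def toShapeGroup (x₀ : X) : FundamentalGroup X x₀ →* shapeGroup x₀ :=
  (MonoidHom.pi fun P : PointedNormalCover x₀ => P.toNerve).codRestrict (shapeGroup x₀)
    fun g _ _ b => PointedNormalCover.hom_toNerve b g

/-- Shape injectivity with respect to the base point `x₀`. -/
def ShapeInjective (x₀ : X) : Prop :=
  Function.Injective (toShapeGroup x₀)

/-! ### The lasso homotopically Hausdorff property -/

/-- The subgroup `π(𝒰, x)` of `π₁(X, x)` generated by the lassos `α γ α⁻¹`, where `α` is a path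
starting at `x` and `γ` is a loop in some member of `𝒰`. -/
noncomputable def lassoSubgroup (𝒰 : Set (Set X)) (x : X) : Subgroup (FundamentalGroup X x) :=
  Subgroup.closure {g | ∃ (y : X) (α : Path x y) (γ : Path y y) (U : Set X), U ∈ 𝒰 ∧
    Set.range γ ⊆ U ∧ g = FundamentalGroup.fromPath (Path.Homotopic.Quotient.mk
      ((α.trans γ).trans α.symm))}

variable (X) in
/-- For each `x` and each essential loop `γ` at `x` there is a normal open cover `𝒰` with
`[γ] ∉ π(𝒰, x)`. -/
def LassoHomotopicallyHausdorff : Prop :=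
  ∀ (x : X) (γ : FundamentalGroup X x), γ ≠ 1 →
    ∃ 𝒰 : Set (Set X), IsNormalCover 𝒰 ∧ γ ∉ lassoSubgroup 𝒰 x

end Covers

/-! Both directions compare lasso subgroups with the kernels of the maps from π₁(X) to π₁ of the
nerves.

For a normal cover 𝒰, the lasso subgroup π(𝒰, x₀) dies in the nerve of 𝒰: a loop inside U ∈ 𝒰 has
its image contiguous to the vertex U (`lassoSubgroup_le_ker_toNerve`). So if [γ] survives in some
nerve, it lies outside the lasso subgroup of that cover.

Conversely, let 𝒱 be a normal refinement of 𝒰 by path connected sets such that two intersecting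
members lie together in a member of 𝒰 (`IsNormalCover.exists_refinement`). Then the kernel for 𝒱
lies in π(𝒰, x₀). To see this, take holonomy of paths in G = π₁(X, x₀)/π(𝒰, x₀). Paths with common
ends, one in V and one in V', have equal holonomy, because together they bound a loop in a member of
𝒰. Hence transporting from a reference point of V to a point of V ∩ V' and back to a reference point
of V' gives an element of G independent of that point. These elements form a cocycle over the open
stars of the vertices, so they glue to a covering of the nerve with fibre G
(`PathHolonomy.nerveBundle`). The image of a loop of X lifts to a path whose fibre coordinate
records the holonomy. If the image is null-homotopic the lift closes up, so the holonomy is 1 and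
the loop belongs to π(𝒰, x₀) (`PathHolonomy.eq_one_of_map_homotopic_refl`). -/

/-! ### Refining normal covers -/

section

open Set Filter Topology Function

universe v

variable {X : Type*} [TopologicalSpace X]

open Classical in
/-- A partition of unity split and regrouped along a labelling of points that is locally constant
on the closed support of each of its members. -/
noncomputable def PartitionOfUnity.regroup {ι κ : Type*} (f : PartitionOfUnity ι X)
    (p : ι → X → κ) (hp : ∀ i, ∀ x ∈ tsupport (f i), ∀ᶠ z in 𝓝 x, p i z = p i x) :
    PartitionOfUnity κ X :=
  -- Cutting `f i` by a label creates no jumps: near a point, either the label is constant or `f i`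
  -- vanishes.
  have hloc : ∀ i k x, ∃ c : ℝ, ∀ᶠ z in 𝓝 x, (if p i z = k then f i z else 0) = c * f i z := by
    intro i k x
    by_cases hx : x ∈ tsupport (f i)
    · refine ⟨if p i x = k then 1 else 0, (hp i x hx).mono fun z hz => ?_⟩
      rw [hz]; split_ifs <;> simp
    · refine ⟨0, (notMem_tsupport_iff_eventuallyEq.1 hx).mono fun z hz => ?_⟩
      simp [hz]
  have hsupp : ∀ i k, support (fun z => if p i z = k then f i z else 0) ⊆ support (f i) := by
    intro i k z hz
    simp only [mem_support, ne_eq, ite_eq_right_iff, Classical.not_imp] at hz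
    exact hz.2
  have hcont : ∀ k, Continuous fun z => ∑ᶠ i, if p i z = k then f i z else 0 := fun k =>
    continuous_finsum (fun i => continuous_iff_continuousAt.2 fun x => by
      obtain ⟨c, hc⟩ := hloc i k x
      exact ((continuous_const.mul (f i).continuous).continuousAt).congr
        (hc.mono fun z hz => hz.symm))
      (f.locallyFinite.subset fun i => hsupp i k)
  have hsum : ∀ x, ∑ᶠ k, ∑ᶠ i, (if p i x = k then f i x else 0) = 1 := by
    intro x
    have h1 : ∀ k, ∑ᶠ i, (if p i x = k then f i x else 0) =
        ∑ i ∈ f.finsupport x, if p i x = k then f i x else 0 := fun k =>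
      finsum_eq_sum_of_support_subset _ fun i hi => by
        rw [f.coe_finsupport]
        exact hsupp i k hi
    simp only [h1]
    rw [finsum_eq_sum_of_support_subset (s := (f.finsupport x).image fun i => p i x),
      Finset.sum_comm]
    · rw [← f.sum_finsupport (mem_univ x)]
      refine Finset.sum_congr rfl fun i hi => ?_
      rw [Finset.sum_ite_eq, if_pos (Finset.mem_image_of_mem _ hi)]
    · intro k hk
      obtain ⟨i, hi, h⟩ := Finset.exists_ne_zero_of_sum_ne_zero hk
      refine Finset.mem_coe.2 (Finset.mem_image.2 ⟨i, hi, ?_⟩)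
      by_contra h'
      exact h (if_neg h')
  { toFun := fun k => ⟨fun z => ∑ᶠ i, if p i z = k then f i z else 0, hcont k⟩
    locallyFinite' := by
      intro x
      obtain ⟨O, hO, hfin⟩ := f.locallyFinite x
      -- Near `x` each of the finitely many relevant `i` contributes only the label `p i x`, so
      -- finitely many labels occur.
      have hA : ∀ᶠ z in 𝓝 x, ∀ i ∈ hfin.toFinset, f i z ≠ 0 → p i z = p i x := by
        rw [Filter.eventually_all_finset]
        intro i _
        by_cases hx : x ∈ tsupport (f i)
        · exact (hp i x hx).mono fun z hz _ => hz
        · exact (notMem_tsupport_iff_eventuallyEq.1 hx).mono fun z hz h => absurd hz h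
      refine ⟨O ∩ {z | ∀ i ∈ hfin.toFinset, f i z ≠ 0 → p i z = p i x}, inter_mem hO hA,
        (hfin.toFinset.image fun i => p i x).finite_toSet.subset ?_⟩
      rintro k ⟨z, hz, hzO, hzA⟩
      obtain ⟨i, hi⟩ := not_forall.1 fun h => hz (finsum_eq_zero_of_forall_eq_zero h)
      have hi' : p i z = k ∧ f i z ≠ 0 := by
        simpa only [ne_eq, ite_eq_right_iff, Classical.not_imp] using hi
      have hiA : i ∈ hfin.toFinset := hfin.mem_toFinset.2 ⟨z, hi'.2, hzO⟩
      exact Finset.mem_coe.2 (Finset.mem_image.2 ⟨i, hiA, (hzA i hiA hi'.2).symm.trans hi'.1⟩)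
    nonneg' := fun k x => finsum_nonneg fun i => by
      split_ifs
      exacts [f.nonneg i x, le_rfl]
    sum_eq_one' := fun x _ => hsum x
    sum_le_one' := fun x => (hsum x).le }

theorem PartitionOfUnity.exists_of_regroup_ne_zero {ι κ : Type*} (f : PartitionOfUnity ι X)
    (p : ι → X → κ) (hp : ∀ i, ∀ x ∈ tsupport (f i), ∀ᶠ z in 𝓝 x, p i z = p i x) {k : κ} {x : X}
    (h : f.regroup p hp k x ≠ 0) : ∃ i, p i x = k ∧ f i x ≠ 0 := by
  classical
  change (∑ᶠ i, if p i x = k then f i x else 0) ≠ 0 at h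
  obtain ⟨i, hi⟩ := not_forall.1 fun h' => h (finsum_eq_zero_of_forall_eq_zero h')
  exact ⟨i, by simpa only [ne_eq, ite_eq_right_iff, Classical.not_imp] using hi⟩

/-- The pullback of a partition of unity along a continuous map. -/
noncomputable def PartitionOfUnity.comp {ι Y : Type*} [TopologicalSpace Y]
    (f : PartitionOfUnity ι Y) (g : C(X, Y)) : PartitionOfUnity ι X where
  toFun i := (f i).comp g
  locallyFinite' := f.locallyFinite.preimage_continuous g.continuous
  nonneg' i x := f.nonneg i (g x)
  sum_eq_one' x _ := f.sum_eq_one (mem_univ (g x))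
  sum_le_one' x := f.sum_le_one (g x)

/-- A partition of unity with closed supports in the open sets `W i` makes the path components of
the `W i` a normal cover. -/
theorem IsNormalCover.of_pathComponentIn [LocallyPathConnectedSpace X] {ι : Type*}
    (f : PartitionOfUnity ι X) {W : ι → Set X} (hW : ∀ i, IsOpen (W i)) (hf : f.IsSubordinate W) :
    IsNormalCover {V | ∃ i, ∃ x ∈ W i, V = pathComponentIn (W i) x} := by
  classical
  set 𝒱 : Set (Set X) := {V | ∃ i, ∃ x ∈ W i, V = pathComponentIn (W i) x}
  have hmem : ∀ x, ∃ i, x ∈ W i := fun x => by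
    obtain ⟨i, hi⟩ := f.exists_pos (mem_univ x)
    exact ⟨i, hf i (subset_tsupport _ hi.ne')⟩
  refine ⟨?_, ?_, ?_⟩
  · rintro _ ⟨i, x, -, rfl⟩
    exact (hW i).pathComponentIn x
  · refine eq_univ_of_forall fun x => ?_
    obtain ⟨i, hi⟩ := hmem x
    exact ⟨_, ⟨i, x, hi, rfl⟩, mem_pathComponentIn_self hi⟩
  -- Different indices may give the same component as a set, hence the regrouping. Off `W i` the
  -- label is irrelevant because `f i` vanishes there. The default label `d` needs a member of 𝒱, so
  -- empty `X` is split off.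
  · let p : ι → X → Option 𝒱 := fun i x =>
      if h : x ∈ W i then some ⟨pathComponentIn (W i) x, i, x, h, rfl⟩ else none
    rcases isEmpty_or_nonempty X with hX | ⟨⟨a⟩⟩
    · refine ⟨⟨fun _ => 0, fun x => isEmptyElim x, fun _ => le_rfl, fun x => isEmptyElim x,
        fun x => isEmptyElim x⟩, fun _ x => isEmptyElim x⟩
    obtain ⟨j, hj⟩ := hmem a
    let d : 𝒱 := ⟨pathComponentIn (W j) a, j, a, hj, rfl⟩
    have hp : ∀ i, ∀ x ∈ tsupport (f i), ∀ᶠ z in 𝓝 x, (p i z).getD d = (p i x).getD d := by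
      intro i x hx
      have hxW := hf i hx
      filter_upwards [((hW i).pathComponentIn x).mem_nhds (mem_pathComponentIn_self hxW)] with z hz
      have hzW : z ∈ W i := pathComponentIn_subset hz
      simp only [p, hxW, hzW, dif_pos, pathComponentIn_congr hz]
    refine ⟨f.regroup _ hp, fun V x hx => ?_⟩
    obtain ⟨i, rfl, hi⟩ := f.exists_of_regroup_ne_zero _ hp hx
    have hxW : x ∈ W i := hf i (subset_tsupport _ hi)
    simp only [p, hxW, dif_pos, Option.getD_some]
    exact mem_pathComponentIn_self hxW

/-- The barycentric coordinates of a partition of unity form a continuous map to `ℓ^∞`. -/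
theorem PartitionOfUnity.exists_continuous_dist {ι : Type v} (f : PartitionOfUnity ι X) :
    ∃ (Y : Type v) (_ : PseudoMetricSpace Y) (g : C(X, Y)), Function.Surjective g ∧
      ∀ i x z, |f i x - f i z| ≤ dist (g x) (g z) := by
  let _ : TopologicalSpace ι := ⊥
  have : DiscreteTopology ι := ⟨rfl⟩
  let F : X → BoundedContinuousFunction ι ℝ := fun x =>
    BoundedContinuousFunction.ofNormedAddCommGroup (fun i => f i x) continuous_of_discreteTopology 1
      fun i => by rw [Real.norm_eq_abs, abs_of_nonneg (f.nonneg i x)]; exact f.le_one i x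
  have hF : Continuous F := by
    rw [continuous_iff_continuousAt]
    intro x
    rw [ContinuousAt, Metric.tendsto_nhds]
    intro ε hε
    obtain ⟨O, hO, hfin⟩ := f.locallyFinite x
    have hA : ∀ᶠ z in 𝓝 x, ∀ i ∈ hfin.toFinset, dist (f i z) (f i x) < ε / 2 := by
      rw [Filter.eventually_all_finset]
      exact fun i _ => Metric.tendsto_nhds.1 ((f i).continuous.tendsto x) _ (half_pos hε)
    filter_upwards [hO, hA] with z hz hzA
    refine lt_of_le_of_lt ((BoundedContinuousFunction.dist_le (half_pos hε).le).2 fun i => ?_)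
      (half_lt_self hε)
    change dist (f i z) (f i x) ≤ ε / 2
    by_cases hi : i ∈ hfin.toFinset
    · exact (hzA i hi).le
    -- All but finitely many coordinates vanish identically on `O`, which makes the estimate uniform
    -- in `i`.
    · have h0 : ∀ y ∈ O, f i y = 0 := fun y hy => by
        by_contra h
        exact hi (hfin.mem_toFinset.2 ⟨y, h, hy⟩)
      rw [h0 z hz, h0 x (mem_of_mem_nhds hO), dist_self]
      exact (half_pos hε).le
  -- Passing to the range makes the map surjective, so that balls centred at image points cover the
  -- target.
  refine ⟨range F, inferInstance, ⟨rangeFactorization F, hF.subtype_mk _⟩,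
    rangeFactorization_surjective, fun i x z => ?_⟩
  exact (Real.dist_eq _ _).symm.le.trans
    (BoundedContinuousFunction.dist_coe_le_dist (f := F x) (g := F z) i)

/-- A normal cover of a locally path connected space has a normal refinement by path connected
sets such that the union of two intersecting members lies in a member of the given cover. -/
theorem IsNormalCover.exists_refinement [LocallyPathConnectedSpace X] {𝒰 : Set (Set X)}
    (h𝒰 : IsNormalCover 𝒰) : ∃ 𝒱 : Set (Set X), IsNormalCover 𝒱 ∧
      (∀ V ∈ 𝒱, IsPathConnected V) ∧
      ∀ V ∈ 𝒱, ∀ V' ∈ 𝒱, (V ∩ V').Nonempty → ∃ U ∈ 𝒰, V ∪ V' ⊆ U := by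
  obtain ⟨φ, hφ⟩ := h𝒰.exists_partition
  obtain ⟨Y, _, g, hg, hdist⟩ := φ.exists_continuous_dist
  choose u hu using fun x => φ.exists_pos (mem_univ x)
  let B : X → Set Y := fun x => Metric.ball (g x) (φ (u x) x / 4)
  -- `X` itself need not be normal or paracompact; the pseudometric target is, and supplies closed
  -- supports inside the balls.
  obtain ⟨ψ, hψ⟩ := PartitionOfUnity.exists_isSubordinate isClosed_univ B
    (fun _ => Metric.isOpen_ball) fun y _ => by
      obtain ⟨x, rfl⟩ := hg y
      exact mem_iUnion.2 ⟨x, Metric.mem_ball_self (div_pos (hu x) four_pos)⟩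
  refine ⟨_, IsNormalCover.of_pathComponentIn (ψ.comp g) (W := fun x => g ⁻¹' B x)
    (fun x => Metric.isOpen_ball.preimage g.continuous) fun x => ?_, ?_, ?_⟩
  · exact (tsupport_comp_subset_preimage (ψ x) g.continuous).trans (preimage_mono (hψ x))
  · rintro _ ⟨x, z, hz, rfl⟩
    exact isPathConnected_pathComponentIn hz
  -- The larger ball decides. Any point of either ball is within three of its radii of `x`, that is,
  -- closer than 3/4 of `φ (u x) x`; coordinates are 1-Lipschitz, so `φ (u x)` stays positive.
  · have key : ∀ x x' : X, φ (u x') x' ≤ φ (u x) x → (g ⁻¹' B x ∩ g ⁻¹' B x').Nonempty →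
        g ⁻¹' B x ∪ g ⁻¹' B x' ⊆ (u x : Set X) := by
      rintro x x' hle ⟨z, hz, hz'⟩ w hw
      refine hφ (u x) (ne_of_gt ?_)
      simp only [B, mem_preimage, Metric.mem_ball, mem_union] at hz hz' hw
      have h1 := (abs_le.1 (hdist (u x) w x)).1
      have hpos := hu x
      rcases hw with hw | hw
      · linarith
      · have := dist_triangle (g w) (g x') (g x)
        have := dist_triangle_left (g x') (g x) (g z)
        linarith
    rintro _ ⟨x, a, -, rfl⟩ _ ⟨x', a', -, rfl⟩ hne
    have hne' := hne.mono (inter_subset_inter pathComponentIn_subset pathComponentIn_subset)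
    have hsub := union_subset_union (pathComponentIn_subset (F := g ⁻¹' B x) (x := a))
      (pathComponentIn_subset (F := g ⁻¹' B x') (x := a'))
    rcases le_total (φ (u x') x') (φ (u x) x) with h | h
    · exact ⟨u x, (u x).2, hsub.trans (key x x' h hne')⟩
    · exact ⟨u x', (u x').2, hsub.trans (union_comm _ _ ▸ key x' x h (inter_comm _ _ ▸ hne'))⟩

end

/-! ### The kernel of the homomorphism to the fundamental group of a nerve -/

section

open Set Filter Topology Function

variable {X : Type*}

/-- A point of `X` in all the members of a cover which are vertices of the carrier of `p`. -/
noncomputable def Realization.witness {𝒱 : Set (Set X)} (p : Realization (nerve 𝒱)) : X :=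
  p.support_mem.2.some

theorem Realization.witness_mem {𝒱 : Set (Set X)} (p : Realization (nerve 𝒱)) {V : 𝒱}
    (hV : p.weight V ≠ 0) : p.witness ∈ V.1 :=
  mem_iInter₂.1 p.support_mem.2.some_mem V (Finsupp.mem_support_iff.2 hV)

variable [TopologicalSpace X]

/-! ### Restrictions of a path to parameter intervals -/

theorem unitInterval_contractibleSpace : ContractibleSpace I :=
  (convex_Icc (0 : ℝ) 1).contractibleSpace ⟨0, unitInterval.zero_mem⟩

/-- The path traversed by `g` between two parameters. -/
noncomputable def Path.betweenParams {x y : X} (g : Path x y) (s t : I) : Path (g s) (g t) :=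
  (⟨⟨fun r => ⟨AffineMap.lineMap (s : ℝ) (t : ℝ) (r : ℝ),
      (convex_Icc (0 : ℝ) 1).lineMap_mem s.2 t.2 r.2⟩, by
        refine Continuous.subtype_mk ?_ _
        exact AffineMap.lineMap_continuous.comp continuous_subtype_val⟩,
    Subtype.ext (by simp), Subtype.ext (by simp)⟩ : Path s t).map g.continuous

/-- Parameters between `s` and `t` are no farther from `s` than `t` is, so they stay in any ball
about `s` containing `t`. -/
theorem Path.eventually_betweenParams_mem {x y : X} (g : Path x y) {V : Set X} (hV : IsOpen V)
    {s : I} (hs : g s ∈ V) : ∀ᶠ t in 𝓝 s, ∀ r, g.betweenParams s t r ∈ V := by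
  obtain ⟨ε, hε, hball⟩ := Metric.mem_nhds_iff.1 ((hV.preimage g.continuous).mem_nhds hs)
  filter_upwards [Metric.ball_mem_nhds s hε] with t ht r
  refine hball (?_ : _ < ε)
  refine lt_of_le_of_lt ?_ ht
  change dist (AffineMap.lineMap (s : ℝ) (t : ℝ) (r : ℝ)) (s : ℝ) ≤ dist (t : ℝ) (s : ℝ)
  rw [dist_lineMap_left, dist_comm (t : ℝ), Real.norm_eq_abs, abs_of_nonneg r.2.1]
  exact mul_le_of_le_one_left dist_nonneg r.2.2

/-- The interval is simply connected, so the two parameter paths are homotopic before `g` is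
applied. -/
theorem Path.betweenParams_trans_homotopic {x y : X} (g : Path x y) (s t r : I) :
    ((g.betweenParams s t).trans (g.betweenParams t r)).Homotopic (g.betweenParams s r) := by
  have := unitInterval_contractibleSpace
  unfold Path.betweenParams
  rw [← Path.map_trans]
  exact (SimplyConnectedSpace.paths_homotopic _ _).map ⟨g, g.continuous⟩

theorem Path.betweenParams_zero_one_homotopic {x y : X} (g : Path x y) :
    ((g.betweenParams 0 1).cast g.source.symm g.target.symm).Homotopic g := by
  have := unitInterval_contractibleSpace
  let id' : Path (0 : I) 1 := ⟨⟨id, continuous_id⟩, rfl, rfl⟩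
  exact (SimplyConnectedSpace.paths_homotopic _ id').map ⟨g, g.continuous⟩

/-! ### Holonomy and local coordinates -/

/-- A homotopy invariant assignment of group elements to the paths of a space which turns
concatenation into multiplication (in reverse order). -/
structure PathHolonomy (X : Type*) [TopologicalSpace X] (G : Type*) [Group G] where
  toFun : ∀ {x y : X}, Path x y → G
  map_homotopic : ∀ {x y : X} {a b : Path x y}, a.Homotopic b → toFun a = toFun b
  map_trans : ∀ {x y z : X} (a : Path x y) (b : Path y z), toFun (a.trans b) = toFun b * toFun a

namespace PathHolonomy

variable {G : Type*} [Group G] (ρ : PathHolonomy X G)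

theorem map_betweenParams {x y : X} (g : Path x y) (s t r : I) :
    ρ.toFun (g.betweenParams s r) =
      ρ.toFun (g.betweenParams t r) * ρ.toFun (g.betweenParams s t) := by
  rw [← ρ.map_trans, ρ.map_homotopic (g.betweenParams_trans_homotopic s t r)]

theorem map_betweenParams_self {x y : X} (g : Path x y) (s : I) :
    ρ.toFun (g.betweenParams s s) = 1 :=
  left_eq_mul.1 (ρ.map_betweenParams g s s s)

theorem map_cast {x y x' y' : X} (g : Path x y) (hx : x' = x) (hy : y' = y) :
    ρ.toFun (g.cast hx hy) = ρ.toFun g := by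
  subst hx hy; rfl

theorem map_betweenParams_zero_one {x y : X} (g : Path x y) :
    ρ.toFun (g.betweenParams 0 1) = ρ.toFun g := by
  rw [← ρ.map_homotopic g.betweenParams_zero_one_homotopic, ρ.map_cast]

/-- The holonomy is locally determined by a family `𝒱` of sets: paths with the same end points,
each lying in one of two members of `𝒱`, have the same holonomy. -/
def IsThinOn (𝒱 : Set (Set X)) : Prop :=
  ∀ V ∈ 𝒱, ∀ V' ∈ 𝒱, ∀ (x y : X) (a b : Path x y), (∀ t, a t ∈ V) → (∀ t, b t ∈ V') →
    ρ.toFun a = ρ.toFun b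

open Classical in
/-- The holonomy from a reference point of `V` to `y ∈ V` inside the path connected set `V`. -/
noncomputable def localCoord {V : Set X} (hV : IsPathConnected V) (y : X) : G :=
  if h : y ∈ V then ρ.toFun (hV.joinedIn _ hV.nonempty.some_mem y h).somePath else 1

variable {𝒱 : Set (Set X)} {ρ}

/-- Thinness with `V' = V` makes the choice of path inside `V` immaterial, so the chosen path to `y`
may be prolonged by `w`. -/
theorem IsThinOn.localCoord_eq (hρ : ρ.IsThinOn 𝒱) {V : Set X} (hV𝒱 : V ∈ 𝒱)
    (hV : IsPathConnected V) {y z : X} (w : Path y z) (hw : ∀ t, w t ∈ V) :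
    ρ.localCoord hV z = ρ.toFun w * ρ.localCoord hV y := by
  have hy : y ∈ V := by simpa using hw 0
  have hz : z ∈ V := by simpa using hw 1
  rw [localCoord, localCoord, dif_pos hy, dif_pos hz, ← ρ.map_trans]
  refine hρ V hV𝒱 V hV𝒱 _ _ _ _ (fun t => JoinedIn.somePath_mem _ t) fun t => ?_
  rw [Path.trans_apply]
  split_ifs
  exacts [JoinedIn.somePath_mem _ _, hw _]

/-- The transition element between two intersecting members does not depend on the point. -/
theorem IsThinOn.transition_eq (hρ : ρ.IsThinOn 𝒱) {V V' : Set X} (hV𝒱 : V ∈ 𝒱) (hV'𝒱 : V' ∈ 𝒱)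
    (hV : IsPathConnected V) (hV' : IsPathConnected V') {y z : X} (hy : y ∈ V ∩ V')
    (hz : z ∈ V ∩ V') : (ρ.localCoord hV' y)⁻¹ * ρ.localCoord hV y =
      (ρ.localCoord hV' z)⁻¹ * ρ.localCoord hV z := by
  have h := hV.joinedIn _ hy.1 _ hz.1
  have h' := hV'.joinedIn _ hy.2 _ hz.2
  -- Moving from `y` to `z` multiplies both coordinates on the left by the same element, by thinness
  -- for the pair `V`, `V'`; it cancels.
  rw [hρ.localCoord_eq hV𝒱 hV h.somePath h.somePath_mem,
    hρ.localCoord_eq hV'𝒱 hV' h'.somePath h'.somePath_mem,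
    hρ V hV𝒱 V' hV'𝒱 _ _ h.somePath h'.somePath h.somePath_mem h'.somePath_mem]
  group

end PathHolonomy

/-! ### The covering of the nerve and lifting of loops -/

namespace PathHolonomy

variable {G : Type*} [Group G] [TopologicalSpace G] [DiscreteTopology G] {ρ : PathHolonomy X G}
  {𝒱 : Set (Set X)}

/-- The covering space of the nerve with structure group `G` given by the transition elements of a
holonomy over the open stars of the vertices. -/
noncomputable def nerveBundle (hρ : ρ.IsThinOn 𝒱) (hpc : ∀ V ∈ 𝒱, IsPathConnected V) :
    FiberBundleCore 𝒱 (Realization (nerve 𝒱)) G where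
  baseSet V := {p | p.weight V ≠ 0}
  isOpen_baseSet V := isOpen_ne_fun (Realization.continuous_weight V) continuous_const
  indexAt p := p.support_nonempty.choose
  mem_baseSet_at p := Finsupp.mem_support_iff.1 p.support_nonempty.choose_spec
  -- Evaluating every transition over `p` at the same witness makes the cocycle identity telescope;
  -- that the witness jumps with `p` is harmless by `transition_eq`.
  coordChange V V' p v :=
    (ρ.localCoord (hpc V' V'.2) p.witness)⁻¹ * ρ.localCoord (hpc V V.2) p.witness * v
  coordChange_self V p _ v := by simp
  continuousOn_coordChange V V' := by
    rintro ⟨p, v⟩ ⟨hp, -⟩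
    have hc : ContinuousWithinAt (fun q : Realization (nerve 𝒱) × G =>
        (ρ.localCoord (hpc V' V'.2) p.witness)⁻¹ * ρ.localCoord (hpc V V.2) p.witness * q.2)
        (({p | p.weight V ≠ 0} ∩ {p | p.weight V' ≠ 0}) ×ˢ univ) (p, v) :=
      (continuous_of_discreteTopology.comp continuous_snd :
        Continuous ((fun v => (ρ.localCoord (hpc V' V'.2) p.witness)⁻¹ *
          ρ.localCoord (hpc V V.2) p.witness * v) ∘ Prod.snd)).continuousWithinAt
    refine hc.congr (fun q hq => ?_) rfl
    rw [hρ.transition_eq V.2 V'.2 (hpc V V.2) (hpc V' V'.2)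
      ⟨q.1.witness_mem hq.1.1, q.1.witness_mem hq.1.2⟩ ⟨p.witness_mem hp.1, p.witness_mem hp.2⟩]
  coordChange_comp V V' V'' p _ v := by group

/-- A loop whose image in the nerve is null-homotopic has trivial holonomy. -/
theorem eq_one_of_map_homotopic_refl (hρ : ρ.IsThinOn 𝒱) (hpc : ∀ V ∈ 𝒱, IsPathConnected V)
    (hopen : ∀ V ∈ 𝒱, IsOpen V) (f : C(X, Realization (nerve 𝒱)))
    (hf : ∀ x, ∀ V ∈ (f x).weight.support, x ∈ V.1) {x : X} (g : Path x x)
    (hg : (g.map f.continuous).Homotopic (Path.refl (f x))) : ρ.toFun g = 1 := by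
  let Z := nerveBundle hρ hpc
  have hcov : IsCoveringMap (Bundle.TotalSpace.proj : Z.TotalSpace → _) :=
    FiberBundle.isCoveringMap
  let c : 𝒱 → X → G := fun V => ρ.localCoord (hpc V V.2)
  let idx : I → 𝒱 := fun t => Z.indexAt (f (g t))
  have hidx : ∀ t, g t ∈ (idx t).1 := fun t =>
    hf _ _ (Finsupp.mem_support_iff.2 (Z.mem_baseSet_at (f (g t))))
  let τ : I → G := fun t => ρ.toFun (g.betweenParams 0 t)
  -- In a fixed chart `V` this fibre coordinate is locally constant: as `t` moves, `τ t` and `c V (g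
  -- t)` gain the same left factor. Hence `Γ` is continuous.
  let Γ : I → Z.TotalSpace := fun t => ⟨f (g t), (c (idx t) (g t))⁻¹ * τ t⟩
  have hΓ : Continuous Γ := by
    rw [continuous_iff_continuousAt]
    intro s
    rw [FiberBundle.continuousAt_totalSpace (F := G)]
    refine ⟨(f.continuous.comp g.continuous).continuousAt, ?_⟩
    have hopens : IsOpen {t : I | f (g t) ∈ Z.baseSet (idx s)} :=
      (Z.isOpen_baseSet _).preimage (f.continuous.comp g.continuous)
    refine (continuousAt_const (y := (c (idx s) (g s))⁻¹ * τ s)).congr ?_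
    filter_upwards [hopens.mem_nhds (Z.mem_baseSet_at _),
      g.eventually_betweenParams_mem (hopen _ (idx s).2) (hidx s)] with t ht hw
    change _ = (c (idx s) (f (g t)).witness)⁻¹ * c (idx t) (f (g t)).witness *
      ((c (idx t) (g t))⁻¹ * τ t)
    have h1 := hρ.transition_eq (idx t).2 (idx s).2 (hpc _ (idx t).2) (hpc _ (idx s).2)
      (y := (f (g t)).witness) (z := g t)
      ⟨Realization.witness_mem _ (Z.mem_baseSet_at (f (g t))), Realization.witness_mem _ ht⟩
      ⟨hidx t, hf _ _ (Finsupp.mem_support_iff.2 ht)⟩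
    have h2 : c (idx s) (g t) = _ * c (idx s) (g s) :=
      hρ.localCoord_eq (idx s).2 (hpc _ (idx s).2) (g.betweenParams s t) hw
    have h3 : τ t = _ * τ s := ρ.map_betweenParams g 0 s t
    change (c (idx s) _)⁻¹ * c (idx t) _ = (c (idx s) _)⁻¹ * c (idx t) _ at h1
    rw [h1, h2, h3]
    group
  have hlift := (hcov.eq_liftPath_iff (γ := (g.map f.continuous).toContinuousMap) (e := Γ 0)
    (γ_0 := rfl) (Γ := Γ)).2 ⟨hΓ, rfl, rfl⟩
  -- By homotopy lifting, `Γ` ends where the lift of the constant path does, namely at `Γ 0`.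
  have hend := hcov.liftPath_apply_one_eq_of_homotopicRel hg (Γ 0) rfl
    (congrArg f g.source.symm)
  rw [← hlift] at hend
  have hconst : hcov.liftPath (Path.refl (f x)).toContinuousMap (Γ 0) (congrArg f g.source.symm) 1
      = Γ 0 := congrArg (fun F : C(I, Z.TotalSpace) => F 1) (hcov.liftPath_const _)
  rw [hconst] at hend
  have h01 : g 1 = g 0 := g.target.trans g.source.symm
  have hsnd : (c (idx 1) (g 1))⁻¹ * τ 1 = (c (idx 0) (g 0))⁻¹ * τ 0 :=
    eq_of_heq ((Bundle.TotalSpace.mk.injEq ..).mp hend).2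
  -- The chart depends only on the point of the nerve, so both ends use the same coordinate factor,
  -- which cancels.
  have hi : idx 1 = idx 0 := congrArg (fun y => Z.indexAt (f y)) h01
  rw [hi, h01, mul_right_inj] at hsnd
  rw [← ρ.map_betweenParams_zero_one g]
  exact hsnd.trans (ρ.map_betweenParams_self g 0)

end PathHolonomy

end

/-! ### Lasso subgroups and the main theorem -/

section

open Set

variable {X : Type*} [TopologicalSpace X]

theorem Path.Homotopic.Quotient.symm_trans_cancel_left {x y z : X}
    (a : Path.Homotopic.Quotient x y) (b : Path.Homotopic.Quotient y z) :
    a.symm.trans (a.trans b) = b := by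
  rw [← Path.Homotopic.Quotient.trans_assoc]; simp

/-- Lasso subgroups are preserved by a change of base point. -/
theorem lassoSubgroup_changeBase (𝒰 : Set (Set X)) {x y : X} (p : Path x y)
    {g : FundamentalGroup X x} (hg : g ∈ lassoSubgroup 𝒰 x) :
    FundamentalGroup.fundamentalGroupMulEquivOfPath p g ∈ lassoSubgroup 𝒰 y := by
  have h : lassoSubgroup 𝒰 x ≤ (lassoSubgroup 𝒰 y).comap
      (FundamentalGroup.fundamentalGroupMulEquivOfPath p).toMonoidHom := by
    refine (Subgroup.closure_le _).2 ?_
    rintro _ ⟨z, α, γ, U, hU, hγ, rfl⟩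
    refine Subgroup.subset_closure ⟨z, p.symm.trans α, γ, U, hU, hγ, ?_⟩
    change Path.Homotopic.Quotient.mk (p.symm.trans (((α.trans γ).trans α.symm).trans p)) =
      Path.Homotopic.Quotient.mk (((p.symm.trans α).trans γ).trans (p.symm.trans α).symm)
    simp [Path.Homotopic.Quotient.mk_trans, Path.Homotopic.Quotient.trans_assoc]
  exact h hg

instance lassoSubgroup_normal (𝒰 : Set (Set X)) (x : X) : (lassoSubgroup 𝒰 x).Normal where
  conj_mem n hn g := by
    obtain ⟨p, rfl⟩ := Path.Homotopic.Quotient.mk_surjective g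
    exact lassoSubgroup_changeBase 𝒰 p hn

/-- The holonomy of paths in the fundamental group modulo a lasso subgroup. -/
noncomputable def lassoHolonomy [PathConnectedSpace X] (𝒰 : Set (Set X)) (x₀ : X) :
    PathHolonomy X (FundamentalGroup X x₀ ⧸ lassoSubgroup 𝒰 x₀) where
  toFun {x y} a := QuotientGroup.mk (FundamentalGroup.fromPath (Path.Homotopic.Quotient.mk
    (((PathConnectedSpace.somePath x₀ x).trans a).trans (PathConnectedSpace.somePath x₀ y).symm)))
  map_homotopic h := by
    simp only [Path.Homotopic.Quotient.mk_trans]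
    rw [Path.Homotopic.Quotient.eq.2 h]
  map_trans a b := by
    rw [← QuotientGroup.mk_mul, FundamentalGroup.mul_def]
    refine congrArg QuotientGroup.mk (?_ : (Path.Homotopic.Quotient.mk _ :
      Path.Homotopic.Quotient _ _) = (Path.Homotopic.Quotient.mk _).trans
        (Path.Homotopic.Quotient.mk _))
    simp [Path.Homotopic.Quotient.mk_trans, Path.Homotopic.Quotient.trans_assoc,
      Path.Homotopic.Quotient.symm_trans_cancel_left]

theorem PathHolonomy.map_refl {G : Type*} [Group G] (ρ : PathHolonomy X G) (x : X) :
    ρ.toFun (Path.refl x) = 1 := by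
  have := ρ.map_trans (Path.refl x) (Path.refl x)
  rw [Path.refl_trans_refl] at this
  exact left_eq_mul.1 this

theorem PathHolonomy.map_symm {G : Type*} [Group G] (ρ : PathHolonomy X G) {x y : X}
    (a : Path x y) : ρ.toFun a.symm = (ρ.toFun a)⁻¹ := by
  rw [eq_inv_iff_mul_eq_one, ← ρ.map_trans, ← ρ.map_refl x]
  exact ρ.map_homotopic ⟨(Path.Homotopy.reflTransSymm a).symm⟩

/-- The loop `a b⁻¹` runs in `V ∪ V'`, hence in a member of 𝒰; joined to `x₀` it is one of the
generating lassos. -/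
theorem lassoHolonomy_isThinOn [PathConnectedSpace X] {𝒰 𝒱 : Set (Set X)}
    (h : ∀ V ∈ 𝒱, ∀ V' ∈ 𝒱, (V ∩ V').Nonempty → ∃ U ∈ 𝒰, V ∪ V' ⊆ U) (x₀ : X) :
    (lassoHolonomy 𝒰 x₀).IsThinOn 𝒱 := by
  intro V hV V' hV' x y a b ha hb
  obtain ⟨U, hU, hVU⟩ := h V hV V' hV' ⟨x, by simpa using ha 0, by simpa using hb 0⟩
  have h1 : (lassoHolonomy 𝒰 x₀).toFun (a.trans b.symm) = 1 := by
    refine (QuotientGroup.eq_one_iff _).2 (Subgroup.subset_closure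
      ⟨x, PathConnectedSpace.somePath x₀ x, a.trans b.symm, U, hU, ?_, rfl⟩)
    rw [Path.trans_range, Path.symm_range]
    refine union_subset ?_ ?_
    · rintro _ ⟨t, rfl⟩
      exact hVU (Or.inl (ha t))
    · rintro _ ⟨t, rfl⟩
      exact hVU (Or.inr (hb t))
  rw [PathHolonomy.map_trans, PathHolonomy.map_symm] at h1
  exact (inv_mul_eq_one.1 h1).symm

/-- The chosen path from `x₀` to itself need not be constant, so the holonomy of `g` is the class of
a conjugate; base change along that path undoes the conjugation. -/
theorem mem_lassoSubgroup_of_lassoHolonomy_eq_one [PathConnectedSpace X] {𝒰 : Set (Set X)}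
    {x₀ : X} {g : Path x₀ x₀} (h : (lassoHolonomy 𝒰 x₀).toFun g = 1) :
    FundamentalGroup.fromPath (Path.Homotopic.Quotient.mk g) ∈ lassoSubgroup 𝒰 x₀ := by
  have h1 := lassoSubgroup_changeBase 𝒰 (PathConnectedSpace.somePath x₀ x₀)
    ((QuotientGroup.eq_one_iff _).1 h)
  convert h1 using 1
  change Path.Homotopic.Quotient.mk g = Path.Homotopic.Quotient.mk ((PathConnectedSpace.somePath x₀ x₀).symm.trans
    ((((PathConnectedSpace.somePath x₀ x₀).trans g).trans
      (PathConnectedSpace.somePath x₀ x₀).symm).trans (PathConnectedSpace.somePath x₀ x₀)))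
  simp [Path.Homotopic.Quotient.mk_trans, Path.Homotopic.Quotient.trans_assoc,
    Path.Homotopic.Quotient.symm_trans_cancel_left]

/-! ### Lassos die in the nerve -/

theorem PointedNormalCover.toNerve_eq_one_iff {x₀ : X} (P : PointedNormalCover x₀)
    (g : Path x₀ x₀) : P.toNerve (FundamentalGroup.fromPath (Path.Homotopic.Quotient.mk g)) = 1 ↔
      (g.map P.canonicalMap.continuous).Homotopic (Path.refl _) := by
  rw [PointedNormalCover.toNerve, MonoidHom.comp_apply]
  exact (map_eq_one_iff _ (FundamentalGroup.fundamentalGroupMulEquivOfPath P.basePath).injective).trans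
    Path.Homotopic.Quotient.eq

open Classical in
/-- The image in the nerve of a loop in a member of the cover is null-homotopic. -/
theorem PointedNormalCover.map_homotopic_refl {x₀ : X} (P : PointedNormalCover x₀) (U : P.sets)
    {y : X} (g : Path y y) (hg : range g ⊆ U.1) :
    (g.map P.canonicalMap.continuous).Homotopic (Path.refl _) := by
  have hgU : ∀ t, g t ∈ U.1 := fun t => hg ⟨t, rfl⟩
  have hy : y ∈ U.1 := by simpa using hgU 0
  let v : P.Nerve := Realization.vertex U (mem_nerve ⟨_, Finset.mem_singleton_self _⟩ y
    fun _ hV => (Finset.mem_singleton.1 hV) ▸ hy)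
  have hv : ∀ V ∈ v.weight.support, V = U := fun V hV => by
    have : v.weight = Finsupp.single U 1 := rfl
    rw [this, Finsupp.support_single U one_ne_zero] at hV
    exact Finset.mem_singleton.1 hV
  have hyV : ∀ V ∈ (P.canonicalMap y).weight.support ∪ v.weight.support, y ∈ V.1 := by
    intro V hV
    rcases Finset.mem_union.1 hV with h | h
    · exact P.canonicalMap_mem h
    · exact hv V h ▸ hy
  have hU : (P.canonicalMap y).weight.support ∪ v.weight.support ∈ (nerve P.sets).faces :=
    mem_nerve ((P.canonicalMap y).support_nonempty.mono Finset.subset_union_left) y hyV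
  let s : Path (P.canonicalMap y) v := Realization.segment _ _ hU
  have hs : CarriedBy s (Path.refl y) :=
    ⟨⟨_, fun t => Realization.comb_support _ _ hU t⟩,
      fun t V hV => hyV V (Realization.comb_support _ _ hU t hV)⟩
  have hc : CarriedBy (Path.refl v) g :=
    ⟨⟨_, fun _ => Finset.Subset.refl v.weight.support⟩, fun t V hV => hv V hV ▸ hgU t⟩
  -- Contiguity compares paths carried by the same path of `X`, so the image of `g` is padded with
  -- constant paths to match the detour through the vertex `U`.
  have hr := CarriedBy.canonicalMap P (Path.refl y)
  have h := ((hr.trans (CarriedBy.canonicalMap P g)).trans hr.symm).homotopic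
    ((hs.trans hc).trans hs.symm)
  have hrefl : (Path.refl y).map P.canonicalMap.continuous = Path.refl _ := rfl
  rw [hrefl, ← Path.Homotopic.Quotient.eq] at h
  rw [← Path.Homotopic.Quotient.eq]
  simpa [Path.Homotopic.Quotient.mk_trans, Path.Homotopic.Quotient.mk_symm] using h

theorem lassoSubgroup_le_ker_toNerve {x₀ : X} (P : PointedNormalCover x₀) :
    lassoSubgroup P.sets x₀ ≤ P.toNerve.ker := by
  refine (Subgroup.closure_le _).2 ?_
  rintro _ ⟨y, α, γ, U, hU, hγ, rfl⟩
  refine MonoidHom.mem_ker.2 ((P.toNerve_eq_one_iff _).2 ?_)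
  have h := Path.Homotopic.Quotient.eq.2 (P.map_homotopic_refl ⟨U, hU⟩ γ hγ)
  rw [← Path.Homotopic.Quotient.eq, Path.map_trans, Path.map_trans,
    Path.Homotopic.Quotient.mk_trans, Path.Homotopic.Quotient.mk_trans, h, ← Path.map_symm, Path.Homotopic.Quotient.mk_symm]
  simp

end

theorem theorem3p6 {X : Type*} [TopologicalSpace X] [PathConnectedSpace X]
    [LocallyPathConnectedSpace X] (x₀ : X) :
    LassoHomotopicallyHausdorff X ↔ ShapeInjective x₀ := by
  constructor
  · intro hX
    refine (injective_iff_map_eq_one _).2 fun g hg => ?_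
    by_contra hne
    obtain ⟨𝒰, h𝒰, hg𝒰⟩ := hX x₀ g hne
    obtain ⟨𝒱, h𝒱, hpc, hthin⟩ := h𝒰.exists_refinement
    obtain ⟨V₀, hV₀, hx₀⟩ := Set.mem_sUnion.1 (h𝒱.cover.symm ▸ Set.mem_univ x₀)
    let P : PointedNormalCover x₀ := ⟨𝒱, h𝒱, ⟨V₀, hV₀⟩, hx₀⟩
    have hP : P.toNerve g = 1 := congrFun (congrArg Subtype.val hg) P
    obtain ⟨β, rfl⟩ := Path.Homotopic.Quotient.mk_surjective g
    let _ : TopologicalSpace (FundamentalGroup X x₀ ⧸ lassoSubgroup 𝒰 x₀) := ⊥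
    have : DiscreteTopology (FundamentalGroup X x₀ ⧸ lassoSubgroup 𝒰 x₀) := ⟨rfl⟩
    exact hg𝒰 (mem_lassoSubgroup_of_lassoHolonomy_eq_one
      (PathHolonomy.eq_one_of_map_homotopic_refl (lassoHolonomy_isThinOn hthin x₀) hpc h𝒱.isOpen
        P.canonicalMap (fun _ _ => P.canonicalMap_mem) β ((P.toNerve_eq_one_iff β).1 hP)))
  · intro hinj x g hg
    -- Shape injectivity is given only at `x₀`, whereas the loop is based at an arbitrary `x`; base
    -- change preserves both nontriviality and lasso membership.
    let p := PathConnectedSpace.somePath x x₀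
    have hg' : FundamentalGroup.fundamentalGroupMulEquivOfPath p g ≠ 1 :=
      (map_ne_one_iff _ (MulEquiv.injective _)).2 hg
    have hne := (map_ne_one_iff _ hinj).2 hg'
    obtain ⟨P, hP⟩ := Function.ne_iff.1 (fun h => hne (Subtype.ext h))
    exact ⟨P.sets, P.normal, fun hmem =>
      hP (lassoSubgroup_le_ker_toNerve P (lassoSubgroup_changeBase _ p hmem))⟩
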